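/- For a finite group $G$, let $\mathcal{U}(\mathbb{Z}[G])$ be the group of units of the integral group ring $\mathbb{Z}[G]$. We say that $G$ has the cut-property if every central unit is trivial, i.e. if the centre of $\mathcal{U}(\mathbb{Z}[G])$ is $\{\pm g : g \in \mathcal{Z}(G)\}$, where $\mathcal{Z}(G)$ is the centre of $G$. Let $G$ be a finite $3$-group. Then $G$ has the cut-property if and only if $x^{2}$ is conjugate in $G$ to $x^{-1}$ for every $x \in G$. Furthermore, suppose that $G$ has the cut-property. Let $\gamma_1(G) = G$, $\gamma_{i+1}(G) = [\gamma_i(G), G]$ be the lower central series, and let $\mathcal{Z}_0(G) = 1$, $\mathcal{Z}_{i+1}(G)/\mathcal{Z}_i(G) = \mathcal{Z}(G/\mathcal{Z}_i(G))$ be the upper central series of $G$. Then $\gamma_i(G)/\gamma_{i+1}(G)$ has exponent exactly $3$ for every $i \ge 1$ with $\gamma_i(G) \neq 1$, and $\mathcal{Z}_{i+1}(G)/\mathcal{Z}_i(G)$ has exponent exactly $3$ for every $i \ge 0$ with $\mathcal{Z}_i(G) \neq G$. -/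

import Mathlib

/-- A group `G` has the cut-property if every central unit of its integral group ring `ℤ[G]` is
trivial: each element of the centre of the unit group of `ℤ[G]` equals `g` or `-g` for some `g` in
the centre of `G`. (Conversely, all such `±g` are always central units.) -/
def HasCutProperty (G : Type*) [Group G] : Prop :=
  ∀ u ∈ Subgroup.center (MonoidAlgebra ℤ G)ˣ, ∃ g ∈ Subgroup.center G,
    (u : MonoidAlgebra ℤ G) = MonoidAlgebra.of ℤ G g ∨
    (u : MonoidAlgebra ℤ G) = -MonoidAlgebra.of ℤ G g

/-!
Write `A` for the centre of `ℤ[G]`, a commutative ring that is finite over `ℤ`. The central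
characters `ω : A → ℚ̄` coming from simple `ℚ̄[G]`-modules `V` satisfy
`dim V • ω z = ∑ g, z g • χ_V g`, and together they are injective on `A`, because `ℚ̄[G]` is
semisimple and hence has trivial Jacobson radical. Since the eigenvalues of `g` on `V` are roots of
unity, a Galois automorphism `σ` raising roots of unity of order dividing `|G|` to the `j`-th power
maps `χ_V g` to `χ_V (g ^ j)`. For a `3`-group, `2` generates the units modulo `|G|`, so all such
powers are controlled by squaring.

*If `x ^ 2` is conjugate to `x⁻¹` for all `x`.* Let `u` be a central unit and let `u*` be its image
under the antiautomorphism inverting group elements. Then `w = u u*` is a symmetric central unit and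
`ω w` is fixed by the Galois group, so `ω w` is a rational integer, and a unit
(`CentralCharacter.hom_mem_range_intCast`). Hence `w ^ 2 = 1`. Comparing coefficients at `1`,
`∑ g, w g ^ 2 = 1` and `w 1 = ∑ g, u g ^ 2 > 0`, so `∑ g, u g ^ 2 = 1` and `u` is trivial.

*If all central units are trivial.* The unit group of `A` is torsion. Let `K` be the number field
generated by `ω(A)`. As `A` is reduced, some `e` in `A` annihilates `ker ω` and has `ω e` a nonzero
integer. A suitable power of any unit of `𝓞 K` is congruent to `1` modulo a given integer, hence
lifts to a unit `1 + e a` of `A` (`exists_unit_not_isOfFinOrder_of_rank_ne_zero`). So `K` has unit rank `0`, i.e. by Dirichlet's unit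
theorem a single infinite place, and the automorphism `ζ ↦ ζ ^ 2` acts on `K` as the identity or as
complex conjugation. Either way `χ_V (x ^ 2) = χ_V x⁻¹` for all `V`, and as central characters
separate the sums over conjugacy classes, `x ^ 2` and `x⁻¹` are conjugate.

*The central series.* If `c x ^ 2 c⁻¹ = x⁻¹`, then `x ^ 3 = ⁅x, c⁻¹⁆`, so cubing moves every term of
the lower central series into the next term, and every term of the upper central series into the
preceding one.
-/

open MonoidAlgebra

/-! ### Roots of unity and traces -/

open Module in
/-- An endomorphism of finite order is diagonalisable, so the traces of its powers are the power
sums of a single family `s` of roots of unity, its eigenvalues with multiplicity. -/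
theorem exists_multiset_trace_pow_eq {L V : Type*} [Field L] [IsAlgClosed L] [CharZero L]
    [AddCommGroup V] [Module L V] [FiniteDimensional L V] (f : Module.End L V) {n : ℕ}
    (hn : n ≠ 0) (hf : f ^ n = 1) :
    ∃ s : Multiset L, (∀ ζ ∈ s, ζ ^ n = 1) ∧
      ∀ j : ℕ, LinearMap.trace L V (f ^ j) = (s.map (· ^ j)).sum := by
  classical
  have hss : f.IsSemisimple := by
    refine Module.End.isSemisimple_of_squarefree_aeval_eq_zero
      (p := (Polynomial.X ^ n - 1 : Polynomial L)) ?_ (by simp [hf])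
    exact (Polynomial.separable_X_pow_sub_C (1 : L) (by exact_mod_cast hn) one_ne_zero).squarefree
  have dec : DirectSum.IsInternal f.eigenspace :=
    DirectSum.isInternal_submodule_of_iSupIndep_of_iSup_eq_top
      f.eigenspaces_iSupIndep hss.iSup_eigenspace_eq_top
  let b := dec.collectedBasis fun μ ↦ finBasis L (f.eigenspace μ)
  have : Fintype ((μ : L) × Fin (finrank L (f.eigenspace μ))) :=
    FiniteDimensional.fintypeBasisIndex b
  have hb : ∀ i, f (b i) = i.1 • b i := fun i ↦
    Module.End.mem_eigenspace_iff.mp (dec.collectedBasis_mem _ i)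
  have hbj : ∀ (j : ℕ) i, (f ^ j) (b i) = i.1 ^ j • b i := by
    intro j i
    induction j with
    | zero => simp
    | succ j ih => rw [pow_succ', Module.End.mul_apply, ih, map_smul, hb, smul_smul, pow_succ]
  refine ⟨Finset.univ.val.map fun i : (μ : L) × Fin (finrank L (f.eigenspace μ)) ↦ i.1, ?_, ?_⟩
  · intro ζ hζ
    obtain ⟨i, -, rfl⟩ := Multiset.mem_map.mp hζ
    have h := hbj n i
    rw [hf, Module.End.one_apply] at h
    have h' : (i.1 ^ n - 1) • b i = 0 := by rw [sub_smul, ← h, one_smul, sub_self]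
    exact sub_eq_zero.mp ((smul_eq_zero.mp h').resolve_right (b.ne_zero i))
  · intro j
    rw [LinearMap.trace_eq_matrix_trace L b, Matrix.trace, Multiset.map_map]
    refine Finset.sum_congr rfl fun i _ ↦ ?_
    simp [LinearMap.toMatrix_apply, hbj]

/-- The residue class of `2` generates the unit group modulo `3 ^ k`: its square `4 = 1 + 3` has
order `3 ^ (k - 1)`, and its own order is even because `2 = -1` modulo `3`. -/
theorem ZMod.exists_two_pow_eq {k : ℕ} (u : (ZMod (3 ^ k))ˣ) :
    ∃ m : ℕ, (2 : ZMod (3 ^ k)) ^ m = u := by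
  rcases k with _ | k
  · exact ⟨0, Subsingleton.elim (α := ZMod 1) _ _⟩
  have : NeZero (3 ^ (k + 1)) := ⟨by positivity⟩
  have h2 : Nat.Coprime 2 (3 ^ (k + 1)) := Nat.Coprime.pow_right _ (by norm_num)
  set v : (ZMod (3 ^ (k + 1)))ˣ := ZMod.unitOfCoprime 2 h2 with hv
  have hvc : (v : ZMod (3 ^ (k + 1))) = 2 := by simp [hv]
  have h4 : orderOf (v ^ 2) = 3 ^ k := by
    rw [← orderOf_units, ← ZMod.orderOf_one_add_prime Nat.prime_three (by norm_num) k]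
    congr 1
    push_cast
    rw [hvc]
    norm_num
  have hcard : Nat.card (ZMod (3 ^ (k + 1)))ˣ = 3 ^ k * 2 := by
    rw [Nat.card_eq_fintype_card, ZMod.card_units_eq_totient,
      Nat.totient_prime_pow_succ Nat.prime_three]
  have hord : orderOf v = Nat.card (ZMod (3 ^ (k + 1)))ˣ := by
    have hdvd : 2 ∣ orderOf v := by
      by_contra hnd
      have hcop : Nat.Coprime (orderOf v) 2 :=
        ((Nat.Prime.coprime_iff_not_dvd Nat.prime_two).mpr hnd).symm
      rw [hcop.orderOf_pow] at h4
      have h1 : (2 : ZMod (3 ^ (k + 1))) ^ (3 ^ k) = 1 := by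
        rw [← hvc, ← Units.val_pow_eq_pow_val, ← h4, pow_orderOf_eq_one, Units.val_one]
      have h1' := congrArg (ZMod.castHom (dvd_pow_self 3 k.succ_ne_zero) (ZMod 3)) h1
      rw [map_pow, map_one, map_ofNat, show (2 : ZMod 3) = -1 from rfl,
        Odd.neg_one_pow (Odd.pow (by decide))] at h1'
      exact absurd h1' (by decide)
    rw [hcard, ← h4, orderOf_pow, Nat.gcd_eq_right hdvd, Nat.div_mul_cancel hdvd]
  have htop : Subgroup.zpowers v = ⊤ := Subgroup.eq_top_of_card_eq _ (by
    rw [Nat.card_zpowers, hord])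
  obtain ⟨m, hm⟩ := mem_powers_iff_mem_zpowers.mpr
    (htop ▸ Subgroup.mem_top u : u ∈ Subgroup.zpowers v)
  exact ⟨m, by rw [← hvc, ← Units.val_pow_eq_pow_val]; exact congrArg _ hm⟩

theorem exists_two_pow_modEq {k j : ℕ} (hj : Nat.Coprime j (3 ^ k)) :
    ∃ m : ℕ, j ≡ 2 ^ m [MOD 3 ^ k] := by
  obtain ⟨m, hm⟩ := ZMod.exists_two_pow_eq (ZMod.unitOfCoprime j hj)
  refine ⟨m, (ZMod.natCast_eq_natCast_iff _ _ _).mp ?_⟩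
  rw [ZMod.coe_unitOfCoprime] at hm
  rw [← hm]
  push_cast
  rfl

theorem exists_algEquiv_pow_of_coprime {L : Type*} [Field L] [Algebra ℚ L]
    [IsAlgClosed L] [Algebra.IsAlgebraic ℚ L] {n j : ℕ}
    (hn : n ≠ 0) (hj : Nat.Coprime j n) :
    ∃ σ : L ≃ₐ[ℚ] L, ∀ ζ : L, ζ ^ n = 1 → σ ζ = ζ ^ j := by
  have : CharZero L := algebraRat.charZero L
  have : NeZero (n : L) := ⟨by exact_mod_cast hn⟩
  have : NeZero n := ⟨hn⟩
  have : IsAlgClosure ℚ L := ⟨inferInstance, inferInstance⟩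
  have : Normal ℚ L := IsAlgClosure.normal ℚ L
  obtain ⟨μ, hμ⟩ := HasEnoughRootsOfUnity.exists_primitiveRoot L n
  have hint : IsIntegral ℤ μ := hμ.isIntegral (Nat.pos_of_ne_zero hn)
  obtain ⟨σ, hσ⟩ := minpoly.exists_algEquiv_of_root' (K := ℚ) (x := μ ^ j) (y := μ)
    (Algebra.IsAlgebraic.isAlgebraic μ) (by
      rw [minpoly.isIntegrallyClosed_eq_field_fractions' ℚ hint, hμ.minpoly_eq_pow_coprime hj,
        ← minpoly.isIntegrallyClosed_eq_field_fractions' ℚ (hint.pow j), minpoly.aeval])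
  refine ⟨σ, fun ζ hζ ↦ ?_⟩
  obtain ⟨i, -, rfl⟩ := hμ.eq_pow_of_pow_eq_one hζ
  rw [map_pow, hσ, pow_right_comm]

theorem exists_coprime_pow_of_ringHom {L : Type*} [Field L] [IsAlgClosed L] [CharZero L] {n : ℕ}
    (hn : n ≠ 0) (σ : L →+* L) :
    ∃ j : ℕ, Nat.Coprime j n ∧ ∀ ζ : L, ζ ^ n = 1 → σ ζ = ζ ^ j := by
  have : NeZero (n : L) := ⟨by exact_mod_cast hn⟩
  have : NeZero n := ⟨hn⟩
  obtain ⟨μ, hμ⟩ := HasEnoughRootsOfUnity.exists_primitiveRoot L n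
  have hσ : IsPrimitiveRoot (σ μ) n := hμ.map_of_injective σ.injective
  obtain ⟨j, -, hcop, hj⟩ := hμ.isPrimitiveRoot_iff.mp hσ
  refine ⟨j, hcop, fun ζ hζ ↦ ?_⟩
  obtain ⟨i, -, rfl⟩ := hμ.eq_pow_of_pow_eq_one hζ
  rw [map_pow, ← hj, pow_right_comm]

/-! ### Lifting units of number fields -/

/-- The kernel `p` of `ω` is a minimal prime, since `A` is integral over `ℤ` and `p` meets `ℤ` in
`0`. As `A` is reduced and Noetherian, `p` is annihilated by an element outside `p`. This element
plays the role of the idempotent cutting out the component of `ℚ ⊗ A` on which `ω` lives. -/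
theorem exists_mul_eq_zero_of_mem_ker {A K : Type*} [CommRing A] [IsReduced A] [Module.Finite ℤ A]
    [Field K] [CharZero K] (ω : A →+* K) :
    ∃ e : A, ω e ≠ 0 ∧ ∀ a, ω a = 0 → e * a = 0 := by
  classical
  have : IsNoetherianRing A := IsNoetherianRing.of_finite ℤ A
  set p := RingHom.ker ω with hp
  have hpp : p.IsPrime := RingHom.ker_isPrime ω
  have hbot : p.comap (algebraMap ℤ A) = ⊥ := by
    refine (Ideal.ext fun z ↦ ?_)
    simp [hp, Ideal.mem_comap, RingHom.mem_ker]
  have hmin : p ∈ (⊥ : Ideal A).minimalPrimes := by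
    refine ⟨⟨hpp, bot_le⟩, fun q hq hqp ↦ ?_⟩
    by_contra hpq
    obtain ⟨x, hxp, hxq⟩ := SetLike.not_le_iff_exists.mp hpq
    have := hq.1
    have hlt := Ideal.comap_lt_comap_of_integral_mem_sdiff hqp ⟨hxp, hxq⟩
      (Algebra.IsIntegral.isIntegral (R := ℤ) x)
    rw [hbot] at hlt
    exact not_lt_bot hlt
  have key : ∀ x ∈ p, ∃ y ∉ p, x * y = 0 := by
    intro x hx
    -- otherwise some prime ideal avoids both `x` and the complement of `p`, against the
    -- minimality of `p`
    by_contra! h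
    have hdisj : Disjoint ((⊥ : Ideal A) : Set A)
        (Submonoid.powers x ⊔ p.primeCompl : Submonoid A) := by
      rw [Set.disjoint_left]
      rintro z hz hzS
      obtain ⟨_, ⟨n, rfl⟩, y, hy, hxy⟩ := Submonoid.mem_sup.mp hzS
      refine h y hy (pow_eq_zero_iff n.succ_ne_zero |>.mp ?_)
      have hxy' : x ^ n * y = 0 := hxy.trans hz
      calc (x * y) ^ (n + 1) = x * y ^ n * (x ^ n * y) := by ring
        _ = 0 := by rw [hxy', mul_zero]
    obtain ⟨q, hq, -, hqS⟩ := Ideal.exists_le_prime_disjoint _ _ hdisj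
    have hqp : q ≤ p := fun z hz ↦ by
      by_contra hzp
      exact Set.disjoint_left.mp hqS hz ((le_sup_right : p.primeCompl ≤ _) hzp)
    exact Set.disjoint_left.mp hqS (hmin.2 ⟨hq, bot_le⟩ hqp hx)
      ((le_sup_left : Submonoid.powers x ≤ _) (Submonoid.mem_powers x))
  choose! y hyp hy using key
  obtain ⟨s, hs⟩ := (isNoetherianRing_iff_ideal_fg A).mp inferInstance p
  have hsp : ∀ x ∈ s, x ∈ p := fun x hx ↦ hs ▸ Ideal.subset_span hx
  refine ⟨∏ x ∈ s, y x, ?_, fun a ha ↦ ?_⟩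
  · rw [map_prod, Finset.prod_ne_zero_iff]
    exact fun x hx ↦ hyp x (hsp x hx)
  · have ha' : a ∈ Ideal.span (s : Set A) := hs ▸ ha
    induction ha' using Submodule.span_induction with
    | mem x hx =>
      rw [← Finset.prod_erase_mul s y hx, mul_assoc, mul_comm (y x), hy x (hsp x hx), mul_zero]
    | zero => simp
    | add u v hu hv h1 h2 => 
      have hu' : u ∈ p := hs ▸ hu
      have hv' : v ∈ p := hs ▸ hv
      rw [mul_add, h1 hu', h2 hv', add_zero]
    | smul c u hu h1 =>
      have hu' : u ∈ p := hs ▸ hu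
      rw [smul_eq_mul, mul_left_comm, h1 hu', mul_zero]

open NumberField in
theorem exists_pow_eq_one_add_mul (K : Type*) [Field K] [NumberField K] (v : (𝓞 K)ˣ) {N : ℕ}
    (hN : N ≠ 0) : ∃ k ≠ 0, ∃ y : 𝓞 K, ((v ^ k : (𝓞 K)ˣ) : 𝓞 K) = 1 + N * y := by
  let I : Ideal (𝓞 K) := Ideal.span {(N : 𝓞 K)}
  have hI : I ≠ ⊥ := by
    simpa [I, Ideal.span_singleton_eq_bot] using hN
  have : Finite (𝓞 K ⧸ I) := Ideal.finiteQuotientOfFreeOfNeBot I hI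
  obtain ⟨k, hk, h⟩ := isOfFinOrder_iff_pow_eq_one.mp
    (isOfFinOrder_of_finite (Units.map (Ideal.Quotient.mk I : 𝓞 K →* 𝓞 K ⧸ I) v))
  refine ⟨k, hk.ne', ?_⟩
  have h' : Ideal.Quotient.mk I ((v ^ k : (𝓞 K)ˣ) : 𝓞 K) = Ideal.Quotient.mk I 1 := by
    simpa using congrArg Units.val h
  obtain ⟨y, hy⟩ := Ideal.mem_span_singleton'.mp (Ideal.Quotient.eq.mp h')
  exact ⟨y, by rw [mul_comm, hy]; ring⟩

open NumberField in
theorem exists_natCast_mul_ringOfIntegers_mem {A K : Type*} [CommRing A]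
    [Field K] [NumberField K] (ω : A →+* K)
    (hω : ∀ y : K, ∃ n : ℕ, n ≠ 0 ∧ ∃ a, n * y = ω a) :
    ∃ m : ℕ, m ≠ 0 ∧ ∀ y : 𝓞 K, ∃ a, m * (y : K) = ω a := by
  classical
  choose n hn a ha using hω
  obtain ⟨s, hs⟩ := (inferInstance : Module.Finite ℤ (𝓞 K)).fg_top
  refine ⟨∏ x ∈ s, n (x : K), Finset.prod_ne_zero_iff.mpr fun x _ ↦ hn x, fun y ↦ ?_⟩
  have hy : y ∈ Submodule.span ℤ (s : Set (𝓞 K)) := hs ▸ Submodule.mem_top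
  induction hy using Submodule.span_induction with
  | mem x hx =>
    refine ⟨(∏ x ∈ s.erase x, n (x : K) : ℕ) * a x, ?_⟩
    rw [← Finset.prod_erase_mul s _ hx, map_mul, ← ha, map_natCast]
    push_cast
    ring
  | zero => exact ⟨0, by simp⟩
  | add u v _ _ h1 h2 =>
    obtain ⟨b, hb⟩ := h1
    obtain ⟨c, hc⟩ := h2
    exact ⟨b + c, by rw [map_add, ← hb, ← hc]; push_cast; ring⟩
  | smul z u _ h1 =>
    obtain ⟨b, hb⟩ := h1
    refine ⟨z * b, ?_⟩
    have hzu : ((z • u : 𝓞 K) : K) = z * (u : K) := by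
      rw [zsmul_eq_mul]; exact (map_mul (algebraMap (𝓞 K) K) _ _).trans (by simp)
    rw [map_mul, ← hb, map_intCast, hzu]
    ring

open NumberField in
theorem exists_unit_not_isOfFinOrder (K : Type*) [Field K] [NumberField K]
    (hK : Units.rank K ≠ 0) : ∃ v : (𝓞 K)ˣ, ¬ IsOfFinOrder v := by
  by_contra! h
  let i : Fin (Units.rank K) := ⟨0, Nat.pos_of_ne_zero hK⟩
  have h0 := (Units.dirichletUnitTheorem.logEmbedding_eq_zero_iff (K := K)).mpr
    (h (Units.fundSystem K i))
  rw [Units.logEmbedding_fundSystem] at h0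
  exact (Units.basisUnitLattice K).ne_zero i (Subtype.ext h0)

open NumberField in
/-- If `K` is the fraction field of `ω(A)` and has positive unit rank, then `A` has a unit of
infinite order: with `e` annihilating `ker ω` and `ω e = N` an integer, a suitable power of a
fundamental unit and its inverse lift to mutually inverse elements `1 + e a` and `1 + e a'`. -/
theorem exists_unit_not_isOfFinOrder_of_rank_ne_zero {A K : Type*} [CommRing A] [IsReduced A]
    [Module.Finite ℤ A] [Field K] [NumberField K] (ω : A →+* K)
    (hω : ∀ y : K, ∃ n : ℕ, n ≠ 0 ∧ ∃ a, n * y = ω a)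
    (hK : Units.rank K ≠ 0) : ∃ u : Aˣ, ¬ IsOfFinOrder u := by
  obtain ⟨e₀, he₀, hker₀⟩ := exists_mul_eq_zero_of_mem_ker ω
  -- rescaling `e₀` makes its image an integer `N`
  obtain ⟨N, hN, b, hb⟩ := hω (ω e₀)⁻¹
  obtain ⟨e, he, hker⟩ : ∃ e, ω e = N ∧ ∀ a, ω a = 0 → e * a = 0 :=
    ⟨e₀ * b, by rw [map_mul, ← hb]; field_simp, fun a ha ↦ by
      rw [mul_right_comm, hker₀ a ha, zero_mul]⟩
  obtain ⟨m, hm, hmO⟩ := exists_natCast_mul_ringOfIntegers_mem ω hω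
  -- `ω e = N`, while `m` clears the denominator of `y`
  have lift : ∀ v : 𝓞 K, (∃ y, v = 1 + (N * m : ℕ) * y) → ∃ a, ω (1 + e * a) = v := by
    rintro _ ⟨y, rfl⟩
    obtain ⟨a, ha⟩ := hmO y
    refine ⟨a, ?_⟩
    rw [map_add, map_mul, map_one, he, ← ha]
    push_cast
    ring
  obtain ⟨v, hv⟩ := exists_unit_not_isOfFinOrder K hK
  obtain ⟨k, hk, y, hy⟩ := exists_pow_eq_one_add_mul K v (mul_ne_zero hN hm)
  set w := v ^ k with hw
  obtain ⟨a, ha⟩ := lift w ⟨y, hy⟩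
  obtain ⟨a', ha'⟩ := lift (w⁻¹ : (𝓞 K)ˣ) ⟨-(w⁻¹ : (𝓞 K)ˣ) * y, by
    have := w.inv_mul
    linear_combination this - (w⁻¹ : (𝓞 K)ˣ) * hy⟩
  have hprod : (1 + e * a) * (1 + e * a') = 1 := by
    have h1 : (1 + e * a) * (1 + e * a') = 1 + e * (a + a' + e * a * a') := by ring
    have h2 : ω ((1 + e * a) * (1 + e * a')) = 1 := by
      rw [map_mul, ha, ha', ← map_mul, Units.mul_inv, map_one]
    rw [h1, map_add, map_one, map_mul, he] at h2
    have h3 : ω (a + a' + e * a * a') = 0 := by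
      have := add_eq_left.mp h2
      exact (mul_eq_zero.mp this).resolve_left (by exact_mod_cast hN)
    rw [h1, hker _ h3, add_zero]
  refine ⟨⟨1 + e * a, 1 + e * a', hprod, by rw [mul_comm, hprod]⟩, fun hfin ↦ hv ?_⟩
  have h4 : IsOfFinOrder (ω (1 + e * a)) := by
    have := (Units.coeHom A).isOfFinOrder hfin
    exact (ω : A →* K).isOfFinOrder this
  rw [ha] at h4
  have h5 : IsOfFinOrder w := by
    have hinj : Function.Injective
      (((algebraMap (𝓞 K) K : 𝓞 K →* K)).comp (Units.coeHom (𝓞 K))) :=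
      (RingOfIntegers.coe_injective).comp Units.val_injective
    exact (hinj.isOfFinOrder_iff).mp h4
  exact (isOfFinOrder_pow.mp h5).resolve_right hk

/-! ### Central characters of the integral group ring -/

/-- The data of a central character of a finite group `G` over a field `L`: the ring homomorphism
`hom` by which the centre of `ℤ[G]` acts on a simple `L[G]`-module, together with the degree `deg`
and the character `char` of that module. Only the properties needed below are recorded, so that the
module itself can be forgotten; in particular, `exists_multiset` says that `char` restricted to the
powers of `g` is given by power sums of roots of unity. -/
structure CentralCharacter (G L : Type*) [Group G] [Fintype G] [Field L] where
  deg : ℕ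
  deg_ne_zero : deg ≠ 0
  char : G → L
  hom : Subring.center (MonoidAlgebra ℤ G) →+* L
  deg_mul_hom : ∀ z, deg * hom z = ∑ g, ((z : MonoidAlgebra ℤ G).coeff g : L) * char g
  char_eq_of_isConj : ∀ {g h}, IsConj g h → char g = char h
  exists_multiset : ∀ g, ∃ s : Multiset L, (∀ ζ ∈ s, ζ ^ Nat.card G = 1) ∧
    ∀ j : ℕ, char (g ^ j) = (s.map (· ^ j)).sum

theorem MonoidAlgebra.commute_map_of_mem_center {G L : Type*} [Group G] [Field L]
    {z : MonoidAlgebra ℤ G} (hz : z ∈ Subring.center (MonoidAlgebra ℤ G)) (x : MonoidAlgebra L G) :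
    Commute (mapRingHom G (Int.castRingHom L) z) x := by
  induction x using MonoidAlgebra.induction_linear with
  | zero => exact Commute.zero_right _
  | add f g hf hg => exact hf.add_right hg
  | single g r =>
    have h1 : single g r = r • mapRingHom G (Int.castRingHom L) (single g 1) := by
      simp [mapRingHom_single]
    have h2 : Commute z (single g 1) := (Subring.mem_center_iff.mp hz _).symm
    rw [h1]
    exact (h2.map _).smul_right r

/-- By Schur's lemma, a simple module gives rise to a central character. -/
theorem CentralCharacter.exists_of_isSimpleModule {G L V : Type*} [Group G] [Fintype G] [Field L]
    [IsAlgClosed L] [CharZero L] [AddCommGroup V] [Module L V] [Module (MonoidAlgebra L G) V]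
    [IsScalarTower L (MonoidAlgebra L G) V] [IsSimpleModule (MonoidAlgebra L G) V]
    [FiniteDimensional L V] :
    ∃ χ : CentralCharacter G L, ∀ (z : Subring.center (MonoidAlgebra ℤ G)) (v : V),
      mapRingHom G (Int.castRingHom L) (z : MonoidAlgebra ℤ G) • v = χ.hom z • v := by
  classical
  set ι := mapRingHom G (Int.castRingHom L) with hι
  have hsc : ∀ z : Subring.center (MonoidAlgebra ℤ G), ∃ c : L, ∀ v : V,
      ι (z : MonoidAlgebra ℤ G) • v = c • v := by
    intro z
    let f : V →ₗ[MonoidAlgebra L G] V :=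
      { toFun := fun v ↦ ι z • v
        map_add' := smul_add _
        map_smul' := fun x v ↦ by
          rw [smul_smul, (commute_map_of_mem_center z.2 x).eq, RingHom.id_apply, smul_smul] }
    obtain ⟨c, hc⟩ := (IsSimpleModule.algebraMap_end_bijective_of_isAlgClosed L).2 f
    exact ⟨c, fun v ↦ (congrArg (fun φ : V →ₗ[MonoidAlgebra L G] V ↦ φ v) hc).symm⟩
  choose c hc using hsc
  have : Nontrivial V := IsSimpleModule.nontrivial (MonoidAlgebra L G) V
  obtain ⟨v₀, hv₀⟩ := exists_ne (0 : V)
  have hinj : ∀ a b : L, a • v₀ = b • v₀ → a = b := fun a b h ↦ smul_left_injective L hv₀ h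
  let ρ : MonoidAlgebra L G →ₐ[L] Module.End L V := Algebra.lsmul L L V
  refine ⟨{
    deg := Module.finrank L V
    deg_ne_zero := Module.finrank_pos.ne'
    char := fun g ↦ LinearMap.trace L V (ρ (of L G g))
    hom :=
      { toFun := c
        map_one' := hinj _ _ (by rw [← hc]; simp)
        map_mul' := fun x y ↦ hinj _ _ (by
          rw [← hc, Subring.coe_mul, map_mul, mul_smul, hc y, hc x, mul_smul])
        map_zero' := hinj _ _ (by rw [← hc]; simp)
        map_add' := fun x y ↦ hinj _ _ (by
          rw [← hc, Subring.coe_add, map_add, add_smul, hc, hc, add_smul]) }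
    deg_mul_hom := fun z ↦ ?_
    char_eq_of_isConj := fun {g h} hgh ↦ ?_
    exists_multiset := fun g ↦ ?_ }, hc⟩
  · have h1 : ρ (ι z) = c z • 1 := LinearMap.ext fun v ↦ hc z v
    have h2 : ι z = ∑ g, ((z : MonoidAlgebra ℤ G).coeff g : L) • of L G g := by
      ext g
      simp [hι, Finsupp.single_apply]
    have h3 := congrArg (LinearMap.trace L V) h1
    rw [h2, map_sum, map_sum, map_smul, LinearMap.trace_one, smul_eq_mul, mul_comm] at h3
    simp only [map_smul, smul_eq_mul] at h3
    exact h3.symm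
  · obtain ⟨k, hk⟩ := isConj_iff.mp hgh
    have h1 : ρ (of L G h) = ρ (of L G (k * g)) * ρ (of L G k⁻¹) := by
      rw [← map_mul, ← map_mul, hk]
    rw [h1, LinearMap.trace_mul_comm, ← map_mul, ← map_mul, inv_mul_cancel_left]
  · obtain ⟨s, hs, hs'⟩ := exists_multiset_trace_pow_eq (ρ (of L G g)) (n := Nat.card G)
      Nat.card_pos.ne' (by rw [← map_pow, ← map_pow, pow_card_eq_one', map_one, map_one])
    exact ⟨s, hs, fun j ↦ by rw [← hs' j, map_pow, map_pow]⟩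

/-- Central characters separate the elements of the centre of `ℤ[G]`, because `L[G]` is semisimple
and therefore the intersection of its maximal left ideals is zero. -/
theorem CentralCharacter.exists_hom_ne_zero {G : Type*} (L : Type*) [Group G] [Fintype G] [Field L]
    [IsAlgClosed L] [CharZero L] {z : Subring.center (MonoidAlgebra ℤ G)} (hz : z ≠ 0) :
    ∃ χ : CentralCharacter G L, χ.hom z ≠ 0 := by
  set ι := mapRingHom G (Int.castRingHom L) with hι
  have hιz : ι z ≠ 0 := fun h ↦ hz <| Subtype.ext <| MonoidAlgebra.ext <| Finsupp.ext fun g ↦ by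
    have := congrArg (fun x ↦ x.coeff g) h
    simpa [hι] using this
  have : NeZero (Nat.card G : L) := ⟨by exact_mod_cast Nat.card_pos.ne'⟩
  have hjac : Ring.jacobson (MonoidAlgebra L G) = ⊥ := IsSemisimpleRing.jacobson_eq_bot _
  rw [Ring.jacobson_eq_sInf_isMaximal] at hjac
  obtain ⟨m, hm, hzm⟩ : ∃ m : Ideal (MonoidAlgebra L G), m.IsMaximal ∧ ι z ∉ m := by
    by_contra! h
    exact hιz ((Submodule.mem_bot _).mp (hjac ▸ Submodule.mem_sInf.mpr fun m hm ↦ h m hm))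
  have hsimple : IsSimpleModule (MonoidAlgebra L G) (MonoidAlgebra L G ⧸ m) :=
    isSimpleModule_iff_isCoatom.mpr hm.out
  have hfin : Module.Finite L (MonoidAlgebra L G) := inferInstance
  have : Module.Finite L (MonoidAlgebra L G ⧸ m) :=
    Module.Finite.of_surjective (m.mkQ.restrictScalars L) m.mkQ_surjective
  obtain ⟨χ, hχ⟩ := CentralCharacter.exists_of_isSimpleModule (G := G) (L := L)
    (V := MonoidAlgebra L G ⧸ m)
  refine ⟨χ, fun h0 ↦ hzm ?_⟩
  have h := hχ z (m.mkQ 1)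
  rw [h0, zero_smul, ← map_smul, smul_eq_mul, mul_one] at h
  exact (Submodule.Quotient.mk_eq_zero m).mp h

/-- Galois action on character values: if `σ` and `τ` differ by `j`-th powers on roots of unity,
then they differ by `g ↦ g ^ j` on character values. -/
theorem CentralCharacter.map_char {G L M : Type*} [Group G] [Fintype G] [Field L] [Semiring M]
    (χ : CentralCharacter G L) (σ τ : L →+* M) {j : ℕ}
    (h : ∀ ζ : L, ζ ^ Nat.card G = 1 → σ ζ = τ ζ ^ j) (g : G) :
    σ (χ.char g) = τ (χ.char (g ^ j)) := by
  obtain ⟨s, hs, hs'⟩ := χ.exists_multiset g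
  have h1 := hs' 1
  simp only [pow_one, Multiset.map_id'] at h1
  rw [h1, hs' j, map_multiset_sum, map_multiset_sum, Multiset.map_map]
  exact congrArg _ (Multiset.map_congr rfl fun ζ hζ ↦ by
    rw [Function.comp_apply, map_pow, h ζ (hs ζ hζ)])

theorem isConj_pow_two_pow {G : Type*} [Group G] (h : ∀ x : G, IsConj (x ^ 2) x⁻¹) (m : ℕ) :
    (∀ x : G, IsConj (x ^ 2 ^ m) x) ∨ (∀ x : G, IsConj (x ^ 2 ^ m) x⁻¹) := by
  have hinv : ∀ x : G, IsConj (x⁻¹ ^ 2) x := fun x ↦ by simpa using h x⁻¹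
  induction m with
  | zero => exact Or.inl fun x ↦ by rw [pow_zero, pow_one]
  | succ m ih =>
    rcases ih with ih | ih
    · exact Or.inr fun x ↦ by
        rw [pow_succ, pow_mul]; exact ((ih x).pow 2).trans (h x)
    · exact Or.inl fun x ↦ by
        rw [pow_succ, pow_mul]; exact ((ih x).pow 2).trans (hinv x)

namespace MonoidAlgebra

section
variable {G : Type*} [Group G]

/-- The antiautomorphism of `ℤ[G]` inverting group elements, as a homomorphism to the opposite ring.
-/
noncomputable def starHom (G : Type*) [Group G] :
    MonoidAlgebra ℤ G →+* (MonoidAlgebra ℤ G)ᵐᵒᵖ :=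
  (lift ℤ (MonoidAlgebra ℤ G)ᵐᵒᵖ G
    { toFun := fun g ↦ MulOpposite.op (of ℤ G g⁻¹)
      map_one' := by rw [inv_one, map_one, MulOpposite.op_one]
      map_mul' := fun g h ↦ by rw [mul_inv_rev, map_mul, MulOpposite.op_mul] }).toRingHom

/-- The image of `z` under the antiautomorphism of `ℤ[G]` inverting group elements. -/
noncomputable def invStar (z : MonoidAlgebra ℤ G) : MonoidAlgebra ℤ G := (starHom G z).unop

theorem invStar_mul (x y : MonoidAlgebra ℤ G) : invStar (x * y) = invStar y * invStar x := by
  simp [invStar]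

theorem invStar_one : invStar (1 : MonoidAlgebra ℤ G) = 1 := by simp [invStar]

theorem invStar_of (g : G) : invStar (of ℤ G g) = of ℤ G g⁻¹ := by
  simp [invStar, starHom]

theorem invStar_add (x y : MonoidAlgebra ℤ G) : invStar (x + y) = invStar x + invStar y := by
  simp [invStar]

theorem coeff_invStar (z : MonoidAlgebra ℤ G) (g : G) : (invStar z).coeff g = z.coeff g⁻¹ := by
  classical
  induction z using MonoidAlgebra.induction_linear with
  | zero => simp [invStar]
  | add x y hx hy => simp [invStar_add, hx, hy]
  | single h r =>
    have : invStar (single h r) = single h⁻¹ r := by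
      have h1 : single h r = (r : MonoidAlgebra ℤ G) * of ℤ G h := by
        rw [← zsmul_eq_mul, ← smul_of]
      rw [h1, invStar, map_mul, map_intCast, MulOpposite.unop_mul, MulOpposite.unop_intCast,
        ← invStar, invStar_of, (Int.commute_cast _ r).eq, ← zsmul_eq_mul, ← smul_of]
    rw [this, coeff_single, coeff_single, Finsupp.single_apply, Finsupp.single_apply]
    simp only [inv_eq_iff_eq_inv]

theorem invStar_invStar (z : MonoidAlgebra ℤ G) : invStar (invStar z) = z := by
  ext g
  rw [coeff_invStar, coeff_invStar, inv_inv]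

theorem mem_center_of_commute_of {z : MonoidAlgebra ℤ G} (h : ∀ g, Commute z (of ℤ G g)) :
    z ∈ Subring.center (MonoidAlgebra ℤ G) := by
  refine Subring.mem_center_iff.mpr fun x ↦ ?_
  suffices Commute z x from this.symm.eq
  induction x using MonoidAlgebra.induction_linear with
  | zero => exact Commute.zero_right _
  | add f g hf hg => exact hf.add_right hg
  | single g r =>
    rw [← smul_of]
    exact (h g).smul_right r

theorem invStar_mem_center {z : MonoidAlgebra ℤ G}
    (hz : z ∈ Subring.center (MonoidAlgebra ℤ G)) :
    invStar z ∈ Subring.center (MonoidAlgebra ℤ G) := by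
  refine mem_center_of_commute_of fun g ↦ ?_
  have h := congrArg invStar (Subring.mem_center_iff.mp hz (of ℤ G g⁻¹))
  rw [invStar_mul, invStar_mul, invStar_of, inv_inv] at h
  exact h

/-- The trace form of `ℤ[G]` is positive definite. -/
theorem coeff_mul_invStar_one [Fintype G] (z : MonoidAlgebra ℤ G) :
    (z * invStar z).coeff 1 = ∑ g, z.coeff g ^ 2 := by
  classical
  rw [coeff_mul_antidiag (s := Finset.univ.image fun g : G ↦ (g, g⁻¹))]
  · rw [Finset.sum_image (fun g _ h _ hgh ↦ (Prod.ext_iff.mp hgh).1)]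
    simp [coeff_invStar, sq]
  · rintro ⟨a, b⟩
    simp only [Finset.mem_image, Finset.mem_univ, true_and, Prod.mk.injEq]
    constructor
    · rintro ⟨g, rfl, rfl⟩
      exact mul_inv_cancel g
    · exact fun h ↦ ⟨a, rfl, inv_eq_of_mul_eq_one_right h⟩

theorem eq_or_eq_neg_of_sum_sq_eq_one [Fintype G] {z : MonoidAlgebra ℤ G}
    (h : ∑ g, z.coeff g ^ 2 = 1) : ∃ g, z = of ℤ G g ∨ z = -of ℤ G g := by
  classical
  obtain ⟨g, hg⟩ : ∃ g, z.coeff g ≠ 0 := by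
    by_contra! h0
    simp [h0] at h
  have h1 : ∀ k, 0 ≤ z.coeff k ^ 2 := fun k ↦ sq_nonneg _
  have hg1 : 1 ≤ z.coeff g ^ 2 := Int.add_one_le_iff.mpr (sq_pos_of_ne_zero hg)
  rw [← Finset.add_sum_erase _ _ (Finset.mem_univ g)] at h
  have h2 : ∑ k ∈ Finset.univ.erase g, z.coeff k ^ 2 = 0 :=
    le_antisymm (by linarith) (Finset.sum_nonneg fun k _ ↦ h1 k)
  have h3 : ∀ k, k ≠ g → z.coeff k = 0 := fun k hk ↦ by
    simpa using (Finset.sum_eq_zero_iff_of_nonneg fun k _ ↦ h1 k).mp h2 k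
      (Finset.mem_erase.mpr ⟨hk, Finset.mem_univ k⟩)
  rw [h2, add_zero, sq_eq_one_iff] at h
  refine ⟨g, h.imp (fun hz ↦ ?_) (fun hz ↦ ?_)⟩ <;> ext k <;> rcases eq_or_ne k g with rfl | hk
  · simp [hz]
  · simp [h3 k hk, hk]
  · simp [hz]
  · simp [h3 k hk, hk]

end

end MonoidAlgebra

instance MonoidAlgebra.finite_center {G : Type*} [Group G] [Finite G] :
    Module.Finite ℤ (Subring.center (MonoidAlgebra ℤ G)) :=
  Module.Finite.of_injective
    (Subring.center (MonoidAlgebra ℤ G)).subtype.toAddMonoidHom.toIntLinearMap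
    Subtype.val_injective

/-! ### Triviality of central units -/

/-- `AlgebraicClosure.isAlgebraic` for the `ℚ`-algebra structure found by unification, which is only
propositionally equal to the one of `AlgebraicClosure`. -/
theorem AlgebraicClosure.isAlgebraic_rat :
    @Algebra.IsAlgebraic ℚ (AlgebraicClosure ℚ) _ _ DivisionRing.toRatAlgebra := by
  have h : (DivisionRing.toRatAlgebra : Algebra ℚ (AlgebraicClosure ℚ)) =
    AlgebraicClosure.instAlgebra ℚ := Subsingleton.elim _ _
  exact h ▸ AlgebraicClosure.isAlgebraic ℚ

/-- If `x ^ 2` is always conjugate to `x⁻¹`, then central characters take rational integer values on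
symmetric central elements: applying a Galois automorphism amounts to replacing `g` by some `g ^ 2 ^
m`, which is conjugate to `g` or `g⁻¹`. -/
theorem CentralCharacter.hom_mem_range_intCast {G L : Type*} [Group G] [Fintype G] [Field L]
    [Algebra ℚ L] [IsAlgClosed L] [Algebra.IsAlgebraic ℚ L] (hG : IsPGroup 3 G)
    (h : ∀ x : G, IsConj (x ^ 2) x⁻¹) (χ : CentralCharacter G L)
    {w : Subring.center (MonoidAlgebra ℤ G)} (hw : invStar (w : MonoidAlgebra ℤ G) = w) :
    ∃ a : ℤ, χ.hom w = a := by
  have : CharZero L := algebraRat.charZero L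
  have : IsAlgClosure ℚ L := ⟨inferInstance, inferInstance⟩
  have : IsGalois ℚ L := IsAlgClosure.isGalois ℚ L
  have hint : IsIntegral ℤ (χ.hom w) :=
    (Algebra.IsIntegral.isIntegral (R := ℤ) w).map χ.hom.toIntAlgHom
  obtain ⟨q, hq⟩ := (InfiniteGalois.mem_range_algebraMap_iff_fixed (χ.hom w)).mpr
    fun σ : L ≃ₐ[ℚ] L ↦ by
      obtain ⟨k, hk⟩ := (IsPGroup.iff_card (p := 3)).mp hG
      obtain ⟨j, hj, hσ⟩ := exists_coprime_pow_of_ringHom (n := Nat.card G) Nat.card_pos.ne'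
        (σ : L →+* L)
      have hσχ : ∀ g, σ (χ.char g) = χ.char (g ^ j) :=
        χ.map_char (σ : L →+* L) (RingHom.id L) hσ
      have hdeg : (χ.deg : L) ≠ 0 := by exact_mod_cast χ.deg_ne_zero
      refine mul_left_cancel₀ hdeg ?_
      rw [χ.deg_mul_hom, ← map_natCast σ, ← map_mul, χ.deg_mul_hom, map_sum]
      simp only [map_mul, map_intCast, hσχ]
      rw [hk] at hj
      obtain ⟨m, hm⟩ := exists_two_pow_modEq hj
      have hpow : ∀ g : G, g ^ j = g ^ 2 ^ m := fun g ↦ by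
        rw [← pow_mod_natCard, hk, hm, ← hk, pow_mod_natCard]
      rcases isConj_pow_two_pow h m with hc | hc
      · exact Finset.sum_congr rfl fun g _ ↦ by rw [hpow, χ.char_eq_of_isConj (hc g)]
      · rw [← Equiv.sum_comp (Equiv.inv G)]
        refine Finset.sum_congr rfl fun g _ ↦ ?_
        rw [hpow, χ.char_eq_of_isConj (hc _), Equiv.inv_apply, inv_inv, ← coeff_invStar, hw]
  rw [← hq, isIntegral_algebraMap_iff (algebraMap ℚ L).injective] at hint
  obtain ⟨a, ha⟩ := IsIntegrallyClosed.isIntegral_iff.mp hint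
  exact ⟨a, by rw [← hq, ← ha]; simp⟩

theorem hasCutProperty_of_isConj {G : Type*} [Group G] [Finite G] (hG : IsPGroup 3 G)
    (h : ∀ x : G, IsConj (x ^ 2) x⁻¹) : HasCutProperty G := by
  cases nonempty_fintype G
  have := AlgebraicClosure.isAlgebraic_rat
  intro u hu
  have hcen : ∀ v ∈ Subgroup.center (MonoidAlgebra ℤ G)ˣ,
      (v : MonoidAlgebra ℤ G) ∈ Subring.center (MonoidAlgebra ℤ G) := fun v hv ↦
    mem_center_of_commute_of fun g ↦ by
      have := Subgroup.mem_center_iff.mp hv (Units.map (of ℤ G) (toUnits g))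
      exact (congrArg Units.val this).symm
  have hinv : ((u⁻¹ : (MonoidAlgebra ℤ G)ˣ) : MonoidAlgebra ℤ G) ∈
      Subring.center (MonoidAlgebra ℤ G) :=
    hcen _ (inv_mem hu)
  let w : Subring.center (MonoidAlgebra ℤ G) := ⟨u, hcen u hu⟩ * ⟨_, invStar_mem_center (hcen u hu)⟩
  let w' : Subring.center (MonoidAlgebra ℤ G) := ⟨_, invStar_mem_center hinv⟩ * ⟨_, hinv⟩
  have hww : w * w' = 1 := by
    refine Subtype.ext ?_
    change (u : MonoidAlgebra ℤ G) * invStar (u : MonoidAlgebra ℤ G) *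
      (invStar ((u⁻¹ : (MonoidAlgebra ℤ G)ˣ) : MonoidAlgebra ℤ G) *
        ((u⁻¹ : (MonoidAlgebra ℤ G)ˣ) : MonoidAlgebra ℤ G)) = 1
    rw [mul_assoc, ← mul_assoc (invStar _), ← invStar_mul, Units.inv_mul, invStar_one, one_mul,
      Units.mul_inv]
  have hw : invStar (w : MonoidAlgebra ℤ G) = w := by
    change invStar (_ * invStar _) = _ * invStar _
    rw [invStar_mul, invStar_invStar]
  have hw' : invStar (w' : MonoidAlgebra ℤ G) = w' := by
    change invStar (invStar _ * _) = invStar _ * _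
    rw [invStar_mul, invStar_invStar]
  have hsq : w * w = 1 := by
    by_contra hne
    obtain ⟨χ, hχ⟩ := CentralCharacter.exists_hom_ne_zero (AlgebraicClosure ℚ) (sub_ne_zero.mpr hne)
    obtain ⟨a, ha⟩ := χ.hom_mem_range_intCast hG h hw
    obtain ⟨b, hb⟩ := χ.hom_mem_range_intCast hG h hw'
    have hab : a * b = 1 := by
      have := congrArg χ.hom hww
      rw [map_mul, ha, hb, map_one] at this
      exact_mod_cast this
    refine hχ ?_
    rw [map_sub, map_mul, map_one, ha]
    rcases Int.eq_one_or_neg_one_of_mul_eq_one hab with rfl | rfl <;> simp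
  have hsqw : ∑ g, (w : MonoidAlgebra ℤ G).coeff g ^ 2 = 1 := by
    rw [← coeff_mul_invStar_one, hw, ← Subring.coe_mul, hsq]
    simp [one_def]
  have hw1 : (w : MonoidAlgebra ℤ G).coeff 1 = ∑ g, (u : MonoidAlgebra ℤ G).coeff g ^ 2 :=
    coeff_mul_invStar_one _
  -- the integer `w 1` is positive with square at most `1`
  have hu1 : ∑ g, (u : MonoidAlgebra ℤ G).coeff g ^ 2 = 1 := by
    have h0 : 0 ≤ (w : MonoidAlgebra ℤ G).coeff 1 := hw1 ▸ Finset.sum_nonneg fun g _ ↦ sq_nonneg _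
    have hne : (w : MonoidAlgebra ℤ G).coeff 1 ≠ 0 := fun h0 ↦ by
      rw [hw1, Finset.sum_eq_zero_iff_of_nonneg fun g _ ↦ sq_nonneg _] at h0
      refine u.ne_zero (MonoidAlgebra.ext (Finsupp.ext fun g ↦ ?_))
      simpa using h0 g (Finset.mem_univ g)
    have hle : (w : MonoidAlgebra ℤ G).coeff 1 ^ 2 ≤ 1 := hsqw ▸
      Finset.single_le_sum (f := fun g ↦ (w : MonoidAlgebra ℤ G).coeff g ^ 2)
        (fun g _ ↦ sq_nonneg _) (Finset.mem_univ 1)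
    rw [← hw1]
    nlinarith [(lt_of_le_of_ne h0 hne.symm : 0 < (w : MonoidAlgebra ℤ G).coeff 1)]
  obtain ⟨g, hg⟩ := eq_or_eq_neg_of_sum_sq_eq_one hu1
  refine ⟨g, Subgroup.mem_center_iff.mpr fun k ↦ ?_, hg⟩
  have hk := Subring.mem_center_iff.mp (hcen u hu) (of ℤ G k)
  refine of_injective (R := ℤ) ?_
  rcases hg with hg | hg <;> rw [hg] at hk <;>
    simpa only [map_mul, mul_neg, neg_mul, neg_inj] using hk

/-! ### Central units of infinite order -/

instance MonoidAlgebra.isReduced_center {G : Type*} [Group G] [Finite G] :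
    IsReduced (Subring.center (MonoidAlgebra ℤ G)) := by
  cases nonempty_fintype G
  refine ⟨fun z hz ↦ ?_⟩
  by_contra hne
  obtain ⟨χ, hχ⟩ := CentralCharacter.exists_hom_ne_zero (AlgebraicClosure ℚ) hne
  exact hχ (hz.map χ.hom).eq_zero

/-- The subfield generated by the image of `ω` is a number field, and it is the fraction field of
this image already with positive integers as denominators. -/
theorem exists_intermediateField_of_ringHom {A L : Type*} [CommRing A] [Module.Finite ℤ A]
    [Field L] [Algebra ℚ L] (ω : A →+* L) :
    ∃ K : IntermediateField ℚ L, FiniteDimensional ℚ K ∧ (∀ a, ω a ∈ K) ∧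
      ∀ y ∈ K, ∃ n : ℕ, n ≠ 0 ∧ ∃ a, n * y = ω a := by
  have : CharZero L := algebraRat.charZero L
  have hint : ∀ a, IsIntegral ℚ (ω a) := fun a ↦
    ((Algebra.IsIntegral.isIntegral (R := ℤ) a).map ω.toIntAlgHom).tower_top
  obtain ⟨s, hs⟩ := (inferInstance : Module.Finite ℤ A).fg_top
  refine ⟨IntermediateField.adjoin ℚ (ω '' s), ?_, fun a ↦ ?_, fun y hy ↦ ?_⟩
  · refine IntermediateField.finiteDimensional_adjoin ?_
    rintro _ ⟨a, -, rfl⟩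
    exact hint a
  · have ha : a ∈ Submodule.span ℤ (s : Set A) := hs ▸ Submodule.mem_top
    induction ha using Submodule.span_induction with
    | mem x hx => exact IntermediateField.subset_adjoin _ _ ⟨x, hx, rfl⟩
    | zero => rw [map_zero]; exact zero_mem _
    | add u v _ _ h1 h2 => rw [map_add]; exact add_mem h1 h2
    | smul z u _ h1 => rw [map_zsmul]; exact zsmul_mem h1 z
  · have hy' : y ∈ Algebra.adjoin ℚ (ω '' s) := by
      rw [← IntermediateField.adjoin_toSubalgebra_of_isAlgebraic]
      · exact hy
      · rintro _ ⟨a, -, rfl⟩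
        exact (hint a).isAlgebraic
    clear hy
    induction hy' using Algebra.adjoin_induction with
    | mem x hx =>
      obtain ⟨a, -, rfl⟩ := hx
      exact ⟨1, one_ne_zero, a, by simp⟩
    | algebraMap q =>
      refine ⟨q.den, q.den_ne_zero, q.num, ?_⟩
      rw [map_intCast, ← map_natCast (algebraMap ℚ L), ← map_mul, mul_comm, Rat.mul_den_eq_num,
        map_intCast]
    | add x y _ _ h1 h2 =>
      obtain ⟨n, hn, a, ha⟩ := h1
      obtain ⟨m, hm, b, hb⟩ := h2
      exact ⟨n * m, mul_ne_zero hn hm, m * a + n * b, by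
        rw [map_add, map_mul, map_mul, map_natCast, map_natCast, ← ha, ← hb]; push_cast; ring⟩
    | mul x y _ _ h1 h2 =>
      obtain ⟨n, hn, a, ha⟩ := h1
      obtain ⟨m, hm, b, hb⟩ := h2
      exact ⟨n * m, mul_ne_zero hn hm, a * b, by
        rw [map_mul, ← ha, ← hb]; push_cast; ring⟩

/-- The sum of all `h x h⁻¹`, `h` in `G`: the class sum of `x` times the order of its centraliser.
-/
noncomputable def conjSum {G : Type*} [Group G] [Fintype G] (x : G) :
    Subring.center (MonoidAlgebra ℤ G) :=
  ⟨∑ h, of ℤ G (h * x * h⁻¹), mem_center_of_commute_of fun g ↦ by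
    rw [commute_iff_eq, Finset.sum_mul, Finset.mul_sum, ← Equiv.sum_comp (Equiv.mulLeft g)]
    refine Finset.sum_congr rfl fun h _ ↦ ?_
    rw [← map_mul, ← map_mul, Equiv.coe_mulLeft]
    congr 1
    group⟩

theorem CentralCharacter.deg_mul_hom_conjSum {G L : Type*} [Group G] [Fintype G] [Field L]
    (χ : CentralCharacter G L) (x : G) :
    χ.deg * χ.hom (conjSum x) = Fintype.card G * χ.char x := by
  classical
  rw [χ.deg_mul_hom]
  have h1 : ∀ g, ((conjSum x : MonoidAlgebra ℤ G).coeff g : L) =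
      ∑ h : G, if h * x * h⁻¹ = g then 1 else 0 := fun g ↦ by
    simp [conjSum, Finsupp.single_apply, Finsupp.finsetSum_apply]
  simp only [h1, Finset.sum_mul, ite_mul, one_mul, zero_mul]
  rw [Finset.sum_comm]
  simp only [Finset.sum_ite_eq, Finset.mem_univ, if_true]
  rw [Finset.sum_congr rfl fun h _ ↦ χ.char_eq_of_isConj
    (isConj_iff.mpr ⟨h, rfl⟩ : IsConj x (h * x * h⁻¹)).symm]
  simp

theorem isConj_of_conjSum_eq {G : Type*} [Group G] [Fintype G] {x y : G}
    (h : conjSum x = conjSum y) : IsConj x y := by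
  classical
  by_contra hxy
  have h1 : ∀ z, (conjSum z : MonoidAlgebra ℤ G).coeff y =
      ∑ h : G, if h * z * h⁻¹ = y then 1 else 0 :=
    fun z ↦ by simp [conjSum, Finsupp.single_apply, Finsupp.finsetSum_apply]
  have h2 := h1 y
  rw [← h, h1 x, Finset.sum_eq_zero fun k _ ↦ if_neg fun hk ↦ hxy (isConj_iff.mpr ⟨k, hk⟩)] at h2
  have h3 := (Finset.sum_eq_zero_iff_of_nonneg fun k _ ↦ by split_ifs <;> simp).mp h2.symm 1
    (Finset.mem_univ 1)
  simp at h3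

theorem HasCutProperty.isOfFinOrder {G : Type*} [Group G] [Finite G] (hcut : HasCutProperty G)
    (u : (Subring.center (MonoidAlgebra ℤ G))ˣ) : IsOfFinOrder u := by
  have hinj : Function.Injective ((Subring.center (MonoidAlgebra ℤ G)).subtype.toMonoidHom.comp
      (Units.coeHom _)) := Subtype.val_injective.comp Units.val_injective
  rw [← hinj.isOfFinOrder_iff]
  obtain ⟨g, -, hg⟩ := hcut (Units.map (Subring.center (MonoidAlgebra ℤ G)).subtype.toMonoidHom u)
    (Subgroup.mem_center_iff.mpr fun v ↦ Units.ext
      (Subring.mem_center_iff.mp (u : Subring.center (MonoidAlgebra ℤ G)).2 v))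
  have hgo : IsOfFinOrder (of ℤ G g) := (of ℤ G).isOfFinOrder (isOfFinOrder_of_finite g)
  change IsOfFinOrder ((u : Subring.center (MonoidAlgebra ℤ G)) : MonoidAlgebra ℤ G)
  change ((u : Subring.center (MonoidAlgebra ℤ G)) : MonoidAlgebra ℤ G) = _ ∨
    ((u : Subring.center (MonoidAlgebra ℤ G)) : MonoidAlgebra ℤ G) = _ at hg
  rcases hg with hg | hg <;> rw [hg]
  · exact hgo
  · rw [← neg_one_mul]
    refine (Commute.neg_one_left _).isOfFinOrder_mul ?_ hgo
    exact isOfFinOrder_iff_pow_eq_one.mpr ⟨2, by norm_num, by simp⟩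

open NumberField in
/-- The field generated by the values of a central character has unit rank `0`, hence a single
infinite place, so the automorphism squaring roots of unity is the identity or complex conjugation
on it. -/
theorem HasCutProperty.char_sq_eq_char_inv {G L : Type*} [Group G] [Fintype G] [Field L]
    [Algebra ℚ L] [IsAlgClosed L] [Algebra.IsAlgebraic ℚ L] (hG : IsPGroup 3 G)
    (hcut : HasCutProperty G) (χ : CentralCharacter G L) (x : G) :
    χ.char (x ^ 2) = χ.char x⁻¹ := by
  have : CharZero L := algebraRat.charZero L
  obtain ⟨k, hk⟩ := (IsPGroup.iff_card (p := 3)).mp hG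
  have hpos : 0 < Nat.card G := Nat.card_pos
  obtain ⟨K, hfin, hmem, hfrac⟩ := exists_intermediateField_of_ringHom χ.hom
  have : NumberField K := 
    -- the two `ℚ`-module structures on `K` are only propositionally equal
    { to_finiteDimensional := by
        convert hfin
        exact Subsingleton.elim _ _ }
  have hrank : Units.rank K = 0 := by
    by_contra hne
    obtain ⟨u, hu⟩ := exists_unit_not_isOfFinOrder_of_rank_ne_zero (χ.hom.codRestrict K hmem)
      (fun y ↦ (hfrac y y.2).imp fun n hn ↦ ⟨hn.1, hn.2.imp fun a ha ↦ Subtype.ext ha⟩) hne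
    exact hu (hcut.isOfFinOrder u)
  have hsub : Subsingleton (InfinitePlace K) := by
    rw [← Fintype.card_le_one_iff_subsingleton]
    exact Nat.sub_eq_zero_iff_le.mp hrank
  obtain ⟨σ, hσ⟩ := exists_algEquiv_pow_of_coprime (L := L) (n := Nat.card G) (j := 2) hpos.ne'
    (by rw [hk]; exact Nat.Coprime.pow_right _ (by norm_num))
  have hσχ : ∀ g, σ (χ.char g) = χ.char (g ^ 2) :=
    χ.map_char (σ : L →+* L) (RingHom.id L) hσ
  have hdeg : (χ.deg : L) ≠ 0 := by exact_mod_cast χ.deg_ne_zero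
  have hcard : (Fintype.card G : L) ≠ 0 := by exact_mod_cast Fintype.card_ne_zero
  have hcharK : ∀ g, χ.char g ∈ K := fun g ↦ by
    have h1 : χ.char g = χ.deg * χ.hom (conjSum g) / Fintype.card G := by
      rw [χ.deg_mul_hom_conjSum]; field_simp
    rw [h1]
    exact div_mem (mul_mem (natCast_mem K _) (hmem _)) (natCast_mem K _)
  have hinv : x ^ (Nat.card G - 1) = x⁻¹ := by
    rw [eq_inv_iff_mul_eq_one, ← pow_succ, Nat.sub_add_cancel hpos, pow_card_eq_one']
  let i : L →+* ℂ := (IsAlgClosed.lift : L →ₐ[ℚ] ℂ)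
  -- `φ` and `ψ` are two embeddings of `K` that differ by `σ`
  let φ : K →+* ℂ := i.comp (algebraMap K L)
  let ψ : K →+* ℂ := (i.comp (σ : L →+* L)).comp (algebraMap K L)
  rcases InfinitePlace.mk_eq_iff.mp (hsub.elim (InfinitePlace.mk φ) (InfinitePlace.mk ψ)) with h | h
  -- if `σ` fixes `K`, all character values are unchanged under `g ↦ g ^ 2`, hence under `g ↦ g⁻¹`
  · have hfix : ∀ g, χ.char (g ^ 2) = χ.char g := fun g ↦ by
      rw [← hσχ]
      exact i.injective (RingHom.congr_fun h ⟨_, hcharK g⟩).symm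
    have hpow : ∀ m : ℕ, ∀ g, χ.char (g ^ 2 ^ m) = χ.char g := by
      intro m
      induction m with
      | zero => simp
      | succ m ih => exact fun g ↦ by rw [pow_succ, pow_mul, hfix, ih]
    have hcop : Nat.Coprime (Nat.card G - 1) (3 ^ k) := by
      rw [← hk]
      conv_rhs => rw [← Nat.sub_add_cancel hpos]
      simp
    obtain ⟨m, hm⟩ := exists_two_pow_modEq hcop
    rw [← hk] at hm
    rw [hfix, ← hinv, ← pow_mod_natCard, hm, pow_mod_natCard, hpow]
  -- if `σ` is complex conjugation on `K`, it acts on character values as inversion of `g`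
  · have h1 : starRingEnd ℂ (i (χ.char x)) = i (σ (χ.char x)) :=
      RingHom.congr_fun h ⟨_, hcharK x⟩
    have h2 := χ.map_char ((starRingEnd ℂ).comp i) i (j := Nat.card G - 1) (fun ζ hζ ↦ by
      have hζ' : i ζ ^ Nat.card G = 1 := by rw [← map_pow, hζ, map_one]
      have hnorm : ‖i ζ‖ = 1 := Complex.norm_eq_one_of_pow_eq_one hζ' hpos.ne'
      have hz0 : i ζ ≠ 0 := norm_ne_zero_iff.mp (by rw [hnorm]; exact one_ne_zero)
      refine mul_right_cancel₀ hz0 ?_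
      rw [← pow_succ, Nat.sub_add_cancel hpos, hζ', RingHom.comp_apply, mul_comm, Complex.mul_conj,
        Complex.normSq_eq_norm_sq, hnorm]
      simp) x
    rw [hinv, RingHom.comp_apply, h1, hσχ] at h2
    exact i.injective h2

theorem isConj_of_hasCutProperty {G : Type*} [Group G] [Finite G] (hG : IsPGroup 3 G)
    (hcut : HasCutProperty G) (x : G) : IsConj (x ^ 2) x⁻¹ := by
  cases nonempty_fintype G
  have := AlgebraicClosure.isAlgebraic_rat
  refine isConj_of_conjSum_eq (sub_eq_zero.mp ?_)
  by_contra hne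
  obtain ⟨χ, hχ⟩ := CentralCharacter.exists_hom_ne_zero (AlgebraicClosure ℚ) hne
  refine hχ ?_
  have hdeg : (χ.deg : AlgebraicClosure ℚ) ≠ 0 := by exact_mod_cast χ.deg_ne_zero
  refine mul_left_cancel₀ hdeg ?_
  rw [map_sub, mul_sub, χ.deg_mul_hom_conjSum, χ.deg_mul_hom_conjSum,
    hcut.char_sq_eq_char_inv hG, sub_self, mul_zero]

/-! ### Exponents of the central factors -/

section
open scoped commutatorElement

variable {G : Type*} [Group G]

theorem cube_mem_of_isConj {N : Subgroup G} {x : G} (hx : IsConj (x ^ 2) x⁻¹)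
    (hN : ∀ y : G, ⁅x, y⁆ ∈ N) : x ^ 3 ∈ N := by
  obtain ⟨c, hc⟩ := isConj_iff.mp hx
  have h2 : x ^ 2 = c⁻¹ * x⁻¹ * c := by rw [← hc]; group
  have h3 : x ^ 3 = ⁅x, c⁻¹⁆ := by
    rw [pow_succ', h2, commutatorElement_def, inv_inv]; group
  exact h3 ▸ hN c⁻¹

theorem exponent_quotient_eq_three {H N : Subgroup G} [(N.subgroupOf H).Normal]
    (hH : ∀ x ∈ H, x ^ 3 ∈ N) (hle : ¬ H ≤ N) :
    Monoid.exponent (H ⧸ N.subgroupOf H) = 3 := by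
  refine ((Nat.dvd_prime Nat.prime_three).mp
    (Monoid.exponent_dvd_of_forall_pow_eq_one ?_)).resolve_left ?_
  · rintro ⟨x⟩
    exact (QuotientGroup.eq_one_iff (N := N.subgroupOf H) (x ^ 3)).mpr
      (Subgroup.mem_subgroupOf.mpr (hH x x.2))
  · rw [Monoid.exp_eq_one_iff, QuotientGroup.subsingleton_iff, Subgroup.subgroupOf_eq_top]
    exact hle

theorem exponent_lowerCentralSeries_quotient [Group.IsNilpotent G]
    (h : ∀ x : G, IsConj (x ^ 2) x⁻¹) {i : ℕ}
    (hi : (⊤ : Subgroup G).lowerCentralSeries i ≠ ⊥) :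
    Monoid.exponent ((⊤ : Subgroup G).lowerCentralSeries i ⧸
      ((⊤ : Subgroup G).lowerCentralSeries (i + 1)).subgroupOf
        ((⊤ : Subgroup G).lowerCentralSeries i)) = 3 := by
  refine exponent_quotient_eq_three (fun x hx ↦ cube_mem_of_isConj (h x) fun y ↦
    Subgroup.commutator_mem_commutator hx (Subgroup.mem_top y)) fun hle ↦ hi ?_
  have hstab : ∀ j, (⊤ : Subgroup G).lowerCentralSeries i ≤
      (⊤ : Subgroup G).lowerCentralSeries (i + j) := by
    intro j
    induction j with
    | zero => exact le_rfl
    | succ j ih => exact hle.trans (Subgroup.commutator_mono ih le_rfl)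
  have hbot := Subgroup.lowerCentralSeries_nilpotencyClass (G := G)
  rw [eq_bot_iff, ← hbot]
  exact (hstab _).trans (Subgroup.lowerCentralSeries_antitone _ (Nat.le_add_left _ _))

theorem exponent_upperCentralSeries_quotient [Group.IsNilpotent G]
    (h : ∀ x : G, IsConj (x ^ 2) x⁻¹) {i : ℕ} (hi : Subgroup.upperCentralSeries G i ≠ ⊤) :
    Monoid.exponent (Subgroup.upperCentralSeries G (i + 1) ⧸
      (Subgroup.upperCentralSeries G i).subgroupOf
        (Subgroup.upperCentralSeries G (i + 1))) = 3 := by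
  refine exponent_quotient_eq_three (fun x hx ↦ cube_mem_of_isConj (h x) fun y ↦
    Subgroup.mem_upperCentralSeries_succ_iff.mp hx y) fun hle ↦ hi ?_
  have hstab : ∀ j, Subgroup.upperCentralSeries G (i + j) ≤ Subgroup.upperCentralSeries G i := by
    intro j
    induction j with
    | zero => exact le_rfl
    | succ j ih =>
      exact le_trans (fun x hx ↦ Subgroup.mem_upperCentralSeries_succ_iff.mpr fun y ↦
        ih (Subgroup.mem_upperCentralSeries_succ_iff.mp hx y)) hle
  have htop := Subgroup.upperCentralSeries_nilpotencyClass (G := G)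
  rw [eq_top_iff, ← htop]
  exact le_trans (Subgroup.upperCentralSeries_mono G (Nat.le_add_left _ _)) (hstab _)
end

theorem theorem2p2 (G : Type*) [Group G] [Finite G] (hG : IsPGroup 3 G) :
    (HasCutProperty G ↔ ∀ x : G, IsConj (x ^ 2) x⁻¹) ∧
    (HasCutProperty G →
      (∀ i : ℕ, (⊤ : Subgroup G).lowerCentralSeries i ≠ ⊥ →
        Monoid.exponent ((⊤ : Subgroup G).lowerCentralSeries i ⧸
          ((⊤ : Subgroup G).lowerCentralSeries (i + 1)).subgroupOf
            ((⊤ : Subgroup G).lowerCentralSeries i)) = 3) ∧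
      (∀ i : ℕ, Subgroup.upperCentralSeries G i ≠ ⊤ →
        Monoid.exponent (Subgroup.upperCentralSeries G (i + 1) ⧸
          (Subgroup.upperCentralSeries G i).subgroupOf
            (Subgroup.upperCentralSeries G (i + 1))) = 3)) := by
  have hiff : HasCutProperty G ↔ ∀ x : G, IsConj (x ^ 2) x⁻¹ :=
    ⟨isConj_of_hasCutProperty hG, hasCutProperty_of_isConj hG⟩
  have : Fact (Nat.Prime 3) := ⟨Nat.prime_three⟩
  have : Group.IsNilpotent G := hG.isNilpotent
  exact ⟨hiff, fun hcut ↦ ⟨fun _ ↦ exponent_lowerCentralSeries_quotient (hiff.mp hcut),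
    fun _ ↦ exponent_upperCentralSeries_quotient (hiff.mp hcut)⟩⟩
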